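/- Let $T$ be an integral domain that is not a field, $M$ a maximal ideal of $T$ (so $M\neq 0$), $K=T/M$ its residue field, $\varphi:T\to K$ the canonical surjection, $D$ a proper subring of $K$, $k=\mathrm{qf}(D)\subseteq K$ the quotient field of $D$, and $R=\varphi^{-1}(D)$ the resulting pullback. For an integral domain $A$, the class semigroup $\mathcal S(A)$ is the commutative semigroup of nonzero fractional ideals of $A$ modulo the nonzero principal fractional ideals. $A$ is called Clifford regular if for every $x\in\mathcal S(A)$ there is $a\in\mathcal S(A)$ with $x^2a=x$, and Boole regular if $x=x^2$ for every $x\in\mathcal S(A)$. $A$ is called strongly discrete if it has no nonzero idempotent prime ideal. Then the following hold. 1. If $R$ is Clifford (resp. Boole) regular, then so are $T$ and $D$, and $[K:k]\leq 2$. 2. Assume that $D=k$ and that $T$ is a valuation (resp. strongly discrete valuation) domain. Then $R$ is Clifford (resp. Boole) regular if and only if $[K:k]=2$. -/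

import Mathlib

open scoped nonZeroDivisors

/-- A commutative semigroup is a Clifford semigroup if every element `x` is von Neumann regular:
`x ^ 2 * a = x` for some `a`. -/
def IsCliffordSemigroup (S : Type*) [CommMonoid S] : Prop :=
  ∀ x : S, ∃ a : S, x ^ 2 * a = x

/-- A commutative semigroup is Boolean if `x = x ^ 2` for every element `x`. -/
def IsBooleanSemigroup (S : Type*) [CommMonoid S] : Prop :=
  ∀ x : S, x = x ^ 2

section ClassSemigroup

variable (R : Type*) [CommRing R] [IsDomain R]

/-- The multiplicative monoid of nonzero fractional ideals of a domain `R`. -/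
def nonzeroFractionalIdeals : Submonoid (FractionalIdeal R⁰ (FractionRing R)) where
  carrier := {I | I ≠ 0}
  one_mem' := one_ne_zero
  mul_mem' := by
    intro I J hI hJ h
    have key : ∀ L : FractionalIdeal R⁰ (FractionRing R), L ≠ 0 → ∃ x ∈ L, x ≠ 0 := by
      intro L hL
      by_contra! hn
      exact hL (FractionalIdeal.eq_zero_iff.mpr hn)
    obtain ⟨x, hx, hx0⟩ := key I hI
    obtain ⟨y, hy, hy0⟩ := key J hJ
    have hxy : x * y ∈ I * J := FractionalIdeal.mul_mem_mul hx hy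
    rw [h, FractionalIdeal.mem_zero_iff] at hxy
    exact mul_ne_zero hx0 hy0 hxy

/-- Congruence of nonzero fractional ideals modulo the nonzero principal fractional ideals:
`I` and `J` are identified when `c I = J` for some nonzero `c` in the quotient field. -/
def principalCon : Con (nonzeroFractionalIdeals R) where
  r I J := ∃ c : FractionRing R, c ≠ 0 ∧
    FractionalIdeal.spanSingleton R⁰ c * (I : FractionalIdeal R⁰ (FractionRing R)) = J
  iseqv :=
    { refl := fun I => ⟨1, one_ne_zero, by simp⟩
      symm := by
        rintro I J ⟨c, hc, h⟩
        refine ⟨c⁻¹, inv_ne_zero hc, ?_⟩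
        rw [← h, ← mul_assoc, FractionalIdeal.spanSingleton_mul_spanSingleton,
          inv_mul_cancel₀ hc, FractionalIdeal.spanSingleton_one, one_mul]
      trans := by
        rintro I J L ⟨c, hc, h⟩ ⟨d, hd, h'⟩
        refine ⟨d * c, mul_ne_zero hd hc, ?_⟩
        rw [← h', ← h, ← mul_assoc, FractionalIdeal.spanSingleton_mul_spanSingleton] }
  mul' := by
    rintro I J L N ⟨c, hc, h⟩ ⟨d, hd, h'⟩
    refine ⟨c * d, mul_ne_zero hc hd, ?_⟩
    rw [Submonoid.coe_mul, Submonoid.coe_mul, ← h, ← h',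
      ← FractionalIdeal.spanSingleton_mul_spanSingleton, mul_mul_mul_comm]

/-- The class semigroup of a domain: nonzero fractional ideals modulo nonzero principal ones. -/
abbrev ClassSemigroup : Type _ := (principalCon R).Quotient

/-- A domain is Clifford regular if its class semigroup is a Clifford semigroup. -/
def IsCliffordRegular : Prop := IsCliffordSemigroup (ClassSemigroup R)

/-- A domain is Boole regular if its class semigroup is a Boolean semigroup. -/
def IsBooleRegular : Prop := IsBooleanSemigroup (ClassSemigroup R)

end ClassSemigroup

/-- A domain is strongly discrete if it has no nonzero idempotent prime ideal. -/
def IsStronglyDiscrete (R : Type*) [CommRing R] : Prop :=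
  ∀ P : Ideal R, P.IsPrime → P ≠ ⊥ → P * P ≠ P

/-- The quotient field of a subring `D` of a field `K`, realized inside `K` as the smallest
subfield of `K` that contains `D`. -/
def quotientFieldIn {K : Type*} [Field K] (D : Subring K) : Subfield K :=
  Subfield.closure (D : Set K)

/-! The kernel `M` is an ideal of both `T` and `R = D.comap φ`, so a nonzero `m ∈ M` multiplies
every `R`-submodule `N` of `T` into `R`. Regularity of `R` thus applies to all nonzero `N`: `N²J =
aN` in the Clifford case, `aN² = bN` in the Boole case.

If `N` is an ideal of `T`, extending this identity to `T` gives regularity of `T`. If `N = φ⁻¹(W)`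
for a nonzero `D`-submodule `W` of `K`, then `NT = T`, so `JT = aT` (resp. `bT = aT`); cancelling
`a` and reducing modulo `M` gives `W²B = W` (resp. `W² = cW`). Taking for `W` the ideals of `D`
gives regularity of `D`. Taking for `W` a finite-dimensional `k`-space containing `1` shows that
each such space is closed under multiplication, which forces `[K:k] ≤ 2`.

Conversely, if `D = k`, `[K:k] = 2` and `T` is a valuation ring, every ideal of `R` is principal or
an ideal of `T` (`isPrincipal_or_exists_restrictScalars_eq`). Ideals of `T` satisfy the required
identities by valuation theory, and multiplication by `m` brings these back to `R`. -/

theorem isCliffordSemigroup_of_isBooleanSemigroup {S : Type*} [CommMonoid S]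
    (h : IsBooleanSemigroup S) : IsCliffordSemigroup S :=
  fun x => ⟨1, by rw [mul_one, ← h x]⟩

/-! ### Regularity tested on integral ideals -/

section IdealCriteria

variable {A : Type*} [CommRing A] [IsDomain A]

open FractionalIdeal

theorem principalCon_iff (I J : nonzeroFractionalIdeals A) :
    (I : ClassSemigroup A) = J ↔ ∃ c : FractionRing A, c ≠ 0 ∧
      spanSingleton A⁰ c * (I : FractionalIdeal A⁰ (FractionRing A)) = J :=
  (principalCon A).eq

/-- Clifford regularity in terms of integral ideals. -/
theorem isCliffordRegular_iff_ideal :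
    IsCliffordRegular A ↔ ∀ I : Ideal A, I ≠ ⊥ →
      ∃ (J : Ideal A) (a : A), a ≠ 0 ∧ I * I * J = Ideal.span {a} * I := by
  constructor
  · intro h I hI
    obtain ⟨y, hy⟩ := h ((⟨(I : FractionalIdeal A⁰ (FractionRing A)),
      coeIdeal_ne_zero.mpr hI⟩ : nonzeroFractionalIdeals A) : ClassSemigroup A)
    induction y using Con.induction_on with
    | H B =>
      rw [pow_two, ← Con.coe_mul, ← Con.coe_mul, principalCon_iff] at hy
      obtain ⟨c, hc, hy⟩ := hy
      obtain ⟨a, J, ha, hJ⟩ := exists_eq_spanSingleton_mul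
        (spanSingleton A⁰ c * (B : FractionalIdeal A⁰ (FractionRing A)))
      refine ⟨J, a, ha, ?_⟩
      apply coeIdeal_injective (K := FractionRing A)
      have ha' : algebraMap A (FractionRing A) a ≠ 0 := by simpa using ha
      simp only [Submonoid.coe_mul] at hy
      simp only [coeIdeal_mul, coeIdeal_span_singleton]
      have hJ' : (J : FractionalIdeal A⁰ (FractionRing A)) =
          spanSingleton A⁰ (algebraMap A (FractionRing A) a) * (spanSingleton A⁰ c * B) := by
        rw [hJ, ← mul_assoc, spanSingleton_mul_spanSingleton, mul_inv_cancel₀ ha',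
          spanSingleton_one, one_mul]
      rw [hJ']
      nth_rw 3 [← hy]
      ring
  · intro h x
    induction x using Con.induction_on with
    | H I =>
      obtain ⟨I, hI0⟩ := I
      obtain ⟨d, N, hd, hN⟩ := exists_eq_spanSingleton_mul I
      have hI0' : I ≠ 0 := hI0
      have hN0 : N ≠ ⊥ := by
        rintro rfl
        simp [hI0'] at hN
      obtain ⟨J, a, ha, hJ⟩ := h N hN0
      have hJ0 : (J : FractionalIdeal A⁰ (FractionRing A)) ≠ 0 := by
        rw [coeIdeal_ne_zero]
        rintro rfl
        rw [Ideal.mul_bot, eq_comm, Ideal.mul_eq_bot, Ideal.span_singleton_eq_bot] at hJ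
        exact hJ.elim ha hN0
      refine ⟨((⟨J, hJ0⟩ : nonzeroFractionalIdeals A) : ClassSemigroup A), ?_⟩
      rw [pow_two, ← Con.coe_mul, ← Con.coe_mul, principalCon_iff]
      have ha' : algebraMap A (FractionRing A) a ≠ 0 := by simpa using ha
      have hd' : algebraMap A (FractionRing A) d ≠ 0 := by simpa using hd
      -- With `I = d⁻¹N`, the relation `N²J = aN` becomes `I²J = (a/d)I`.
      refine ⟨algebraMap A (FractionRing A) d * (algebraMap A (FractionRing A) a)⁻¹,
        mul_ne_zero hd' (inv_ne_zero ha'), ?_⟩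
      have hJ' := congrArg (fun I : Ideal A => (I : FractionalIdeal A⁰ (FractionRing A))) hJ
      simp only [coeIdeal_mul, coeIdeal_span_singleton] at hJ'
      simp only [Submonoid.coe_mul]
      set s := fun x => spanSingleton A⁰ (x : FractionRing A) with hs
      have h1 : s (algebraMap A (FractionRing A) d) * s (algebraMap A (FractionRing A) d)⁻¹ = 1 := by
        simp only [hs, spanSingleton_mul_spanSingleton, mul_inv_cancel₀ hd', spanSingleton_one]
      have h2 : s (algebraMap A (FractionRing A) a)⁻¹ * s (algebraMap A (FractionRing A) a) = 1 := by
        simp only [hs, spanSingleton_mul_spanSingleton, inv_mul_cancel₀ ha', spanSingleton_one]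
      rw [← spanSingleton_mul_spanSingleton]
      subst hN
      change s _ * s _ * ((s _ * _) * (s _ * _) * _) = s _ * _
      change _ = s _ * _ at hJ'
      calc _ = (s (algebraMap A (FractionRing A) d) * s (algebraMap A (FractionRing A) d)⁻¹) *
            s (algebraMap A (FractionRing A) d)⁻¹ * s (algebraMap A (FractionRing A) a)⁻¹ *
            (N * N * J) := by ring
        _ = s (algebraMap A (FractionRing A) d)⁻¹ *
          (s (algebraMap A (FractionRing A) a)⁻¹ * s (algebraMap A (FractionRing A) a)) * N := by
            rw [hJ', h1]; ring
        _ = _ := by rw [h2, mul_one]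

/-- Boole regularity in terms of integral ideals. -/
theorem isBooleRegular_iff_ideal :
    IsBooleRegular A ↔ ∀ I : Ideal A, I ≠ ⊥ →
      ∃ a b : A, a ≠ 0 ∧ b ≠ 0 ∧ Ideal.span {a} * (I * I) = Ideal.span {b} * I := by
  constructor
  · intro h I hI
    have hy := h ((⟨(I : FractionalIdeal A⁰ (FractionRing A)),
      coeIdeal_ne_zero.mpr hI⟩ : nonzeroFractionalIdeals A) : ClassSemigroup A)
    rw [pow_two, ← Con.coe_mul, principalCon_iff] at hy
    obtain ⟨c, hc, hy⟩ := hy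
    obtain ⟨b, a, ha, rfl⟩ := IsFractionRing.div_surjective (A := A) c
    have ha0 : a ≠ 0 := nonZeroDivisors.ne_zero ha
    have ha' : algebraMap A (FractionRing A) a ≠ 0 := by simpa using ha0
    refine ⟨a, b, ha0, by rintro rfl; simp at hc, ?_⟩
    apply coeIdeal_injective (K := FractionRing A)
    simp only [coeIdeal_mul, coeIdeal_span_singleton]
    simp only [Submonoid.coe_mul] at hy
    rw [← hy, ← mul_assoc, spanSingleton_mul_spanSingleton, mul_div_cancel₀ _ ha']
  · intro h x
    induction x using Con.induction_on with
    | H I =>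
      obtain ⟨I, hI0⟩ := I
      obtain ⟨d, N, hd, hN⟩ := exists_eq_spanSingleton_mul I
      have hI0' : I ≠ 0 := hI0
      have hN0 : N ≠ ⊥ := by
        rintro rfl
        simp [hI0'] at hN
      obtain ⟨a, b, ha, hb, hJ⟩ := h N hN0
      rw [pow_two, ← Con.coe_mul, principalCon_iff]
      have ha' : algebraMap A (FractionRing A) a ≠ 0 := by simpa using ha
      have hb' : algebraMap A (FractionRing A) b ≠ 0 := by simpa using hb
      have hd' : algebraMap A (FractionRing A) d ≠ 0 := by simpa using hd
      refine ⟨(algebraMap A (FractionRing A) a)⁻¹ * (algebraMap A (FractionRing A) b) *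
        (algebraMap A (FractionRing A) d)⁻¹,
        mul_ne_zero (mul_ne_zero (inv_ne_zero ha') hb') (inv_ne_zero hd'), ?_⟩
      have hJ' := congrArg (fun I : Ideal A => (I : FractionalIdeal A⁰ (FractionRing A))) hJ
      simp only [coeIdeal_mul, coeIdeal_span_singleton] at hJ'
      simp only [Submonoid.coe_mul]
      rw [← spanSingleton_mul_spanSingleton, ← spanSingleton_mul_spanSingleton]
      subst hN
      set s := fun x => spanSingleton A⁰ (x : FractionRing A) with hs
      have h2 : s (algebraMap A (FractionRing A) a)⁻¹ * s (algebraMap A (FractionRing A) a) = 1 := by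
        simp only [hs, spanSingleton_mul_spanSingleton, inv_mul_cancel₀ ha', spanSingleton_one]
      change s _ * s _ * s _ * (s _ * _) = (s _ * _) * (s _ * _)
      change s _ * _ = s _ * _ at hJ'
      calc _ = s (algebraMap A (FractionRing A) d)⁻¹ ^ 2 * s (algebraMap A (FractionRing A) a)⁻¹ *
            (s (algebraMap A (FractionRing A) b) * N) := by ring
        _ = s (algebraMap A (FractionRing A) d)⁻¹ ^ 2 *
          (s (algebraMap A (FractionRing A) a)⁻¹ * s (algebraMap A (FractionRing A) a)) *
            (N * N) := by rw [← hJ']; ring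
        _ = _ := by rw [h2]; ring

end IdealCriteria

/-! ### Regularity applied to submodules with a common denominator -/

section SubmoduleCriteria

variable {A F : Type*} [CommRing A] [CommRing F] [Algebra A F]

/-- The image of an ideal of `A` in an `A`-algebra `F`. -/
def idealImage (F : Type*) [CommRing F] [Algebra A F] (I : Ideal A) : Submodule A F :=
  Submodule.map (Algebra.linearMap A F) I

theorem mem_idealImage {I : Ideal A} {x : F} :
    x ∈ idealImage F I ↔ ∃ y ∈ I, algebraMap A F y = x := Iff.rfl

theorem idealImage_mul (I J : Ideal A) :
    idealImage F (I * J) = idealImage F I * idealImage F J :=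
  Submodule.map_mul I J (Algebra.ofId A F)

theorem idealImage_span_singleton (a : A) :
    idealImage F (Ideal.span {a}) = Submodule.span A {algebraMap A F a} := by
  unfold idealImage Ideal.span
  rw [Submodule.map_span]
  simp

theorem idealImage_injective (h : Function.Injective (algebraMap A F)) :
    Function.Injective (idealImage F : Ideal A → Submodule A F) :=
  Submodule.map_injective_of_injective h

theorem exists_idealImage_eq {N : Submodule A F}
    (h : ∀ x ∈ N, ∃ y, algebraMap A F y = x) : ∃ I : Ideal A, idealImage F I = N := by
  refine ⟨N.comap (Algebra.linearMap A F), Submodule.map_comap_eq_self ?_⟩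
  intro x hx
  exact h x hx

theorem mem_span_singleton_mul_submodule {a x : F} {N : Submodule A F} :
    x ∈ Submodule.span A {a} * N ↔ ∃ y ∈ N, a * y = x :=
  Submodule.mem_span_singleton_mul

theorem span_singleton_mul_right_injective [IsDomain F] {a : F} (ha : a ≠ 0)
    {N L : Submodule A F} (h : Submodule.span A {a} * N = Submodule.span A {a} * L) : N = L := by
  have key : ∀ {N L : Submodule A F}, Submodule.span A {a} * N = Submodule.span A {a} * L →
      N ≤ L := by
    intro N L h x hx
    have : a * x ∈ Submodule.span A {a} * L := by
      rw [← h]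
      exact mem_span_singleton_mul_submodule.mpr ⟨x, hx, rfl⟩
    obtain ⟨y, hy, hxy⟩ := mem_span_singleton_mul_submodule.mp this
    rwa [← mul_left_cancel₀ ha hxy]
  exact le_antisymm (key h) (key h.symm)

theorem span_singleton_mul_span_singleton' (a b : F) :
    Submodule.span A {a} * Submodule.span A {b} = Submodule.span A {a * b} := by
  rw [Submodule.span_mul_span, Set.singleton_mul_singleton]

theorem exists_idealImage_eq_span_singleton_mul {N : Submodule A F} {m : A}
    (h : ∀ x ∈ N, ∃ y, algebraMap A F y = algebraMap A F m * x) :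
    ∃ I : Ideal A, idealImage F I = Submodule.span A {algebraMap A F m} * N := by
  refine exists_idealImage_eq fun x hx => ?_
  obtain ⟨y, hy, rfl⟩ := mem_span_singleton_mul_submodule.mp hx
  exact h y hy

variable [IsDomain F]

theorem idealImage_ne_bot_of_eq_mul (hinj : Function.Injective (algebraMap A F))
    {N : Submodule A F} (hN : N ≠ ⊥) {m : A} (hm : m ≠ 0) {I : Ideal A}
    (hI : idealImage F I = Submodule.span A {algebraMap A F m} * N) : I ≠ ⊥ := by
  rintro rfl
  obtain ⟨x, hx, hx0⟩ := (Submodule.ne_bot_iff N).mp hN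
  have : algebraMap A F m * x ∈ idealImage F (⊥ : Ideal A) := by
    rw [hI]
    exact mem_span_singleton_mul_submodule.mpr ⟨x, hx, rfl⟩
  obtain ⟨y, hy, hxy⟩ := mem_idealImage.mp this
  rw [(Submodule.mem_bot A).mp hy, map_zero, eq_comm] at hxy
  exact mul_ne_zero ((map_ne_zero_iff _ hinj).mpr hm) hx0 hxy

variable [IsDomain A]

theorem IsCliffordRegular.exists_submodule (h : IsCliffordRegular A)
    (hinj : Function.Injective (algebraMap A F)) {N : Submodule A F} (hN : N ≠ ⊥) {m : A}
    (hm : m ≠ 0) (hmN : ∀ x ∈ N, ∃ y, algebraMap A F y = algebraMap A F m * x) :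
    ∃ (J : Submodule A F) (a : F), a ≠ 0 ∧ N * N * J = Submodule.span A {a} * N := by
  obtain ⟨I, hI⟩ := exists_idealImage_eq_span_singleton_mul hmN
  obtain ⟨J, a, ha, hJ⟩ := isCliffordRegular_iff_ideal.mp h I
    (idealImage_ne_bot_of_eq_mul hinj hN hm hI)
  have hJ' := congrArg (idealImage F) hJ
  simp only [idealImage_mul, idealImage_span_singleton, hI] at hJ'
  -- Since `I = mN`, the relation `I²J = aI` reads `N²(m²J) = (am)N`.
  refine ⟨Submodule.span A {algebraMap A F m} * Submodule.span A {algebraMap A F m} *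
    idealImage F J, algebraMap A F a * algebraMap A F m,
    mul_ne_zero ((map_ne_zero_iff _ hinj).mpr ha) ((map_ne_zero_iff _ hinj).mpr hm), ?_⟩
  rw [← span_singleton_mul_span_singleton', mul_assoc (Submodule.span A {algebraMap A F a}), ← hJ']
  ring

theorem IsBooleRegular.exists_submodule (h : IsBooleRegular A)
    (hinj : Function.Injective (algebraMap A F)) {N : Submodule A F} (hN : N ≠ ⊥) {m : A}
    (hm : m ≠ 0) (hmN : ∀ x ∈ N, ∃ y, algebraMap A F y = algebraMap A F m * x) :
    ∃ a b : F, a ≠ 0 ∧ b ≠ 0 ∧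
      Submodule.span A {a} * (N * N) = Submodule.span A {b} * N := by
  obtain ⟨I, hI⟩ := exists_idealImage_eq_span_singleton_mul hmN
  obtain ⟨a, b, ha, hb, hJ⟩ := isBooleRegular_iff_ideal.mp h I
    (idealImage_ne_bot_of_eq_mul hinj hN hm hI)
  have hJ' := congrArg (idealImage F) hJ
  simp only [idealImage_mul, idealImage_span_singleton, hI] at hJ'
  have h0 : ∀ {x : A}, x ≠ 0 → algebraMap A F x ≠ 0 := (map_ne_zero_iff _ hinj).mpr
  refine ⟨algebraMap A F a * algebraMap A F m, algebraMap A F b, mul_ne_zero (h0 ha) (h0 hm),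
    h0 hb, ?_⟩
  apply span_singleton_mul_right_injective (h0 hm)
  rw [← span_singleton_mul_span_singleton', mul_left_comm _ (Submodule.span A {algebraMap A F b}),
    ← hJ']
  ring

end SubmoduleCriteria

/-! ### Ideals of valuation rings -/

section ValuationRing

variable {V : Type*} [CommRing V]

/-- The elements `p` of a ring with `p I ≠ I`; for a valuation ring this is the prime ideal at
which the endomorphism ring `I : I` is the localization. -/
def nonStabilizer (I : Ideal V) : Set V := {p | ∃ x ∈ I, ∀ y ∈ I, p * y ≠ x}

theorem exists_mul_eq_of_notMem_nonStabilizer {I : Ideal V} {s x : V}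
    (hs : s ∉ nonStabilizer I) (hx : x ∈ I) : ∃ y ∈ I, s * y = x := by
  by_contra! h
  exact hs ⟨x, hx, h⟩

theorem one_notMem_nonStabilizer (I : Ideal V) : (1 : V) ∉ nonStabilizer I := by
  rintro ⟨x, hx, h⟩
  exact h x hx (one_mul x)

theorem zero_mem_nonStabilizer {I : Ideal V} (hI : I ≠ ⊥) : (0 : V) ∈ nonStabilizer I := by
  obtain ⟨x, hx, hx0⟩ := (Submodule.ne_bot_iff I).mp hI
  exact ⟨x, hx, fun y _ h => hx0 (by rw [← h, zero_mul])⟩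

theorem mul_mem_nonStabilizer {I : Ideal V} {p : V} (hp : p ∈ nonStabilizer I) (c : V) :
    c * p ∈ nonStabilizer I := by
  obtain ⟨x, hx, h⟩ := hp
  exact ⟨x, hx, fun y hy hxy => h (c * y) (I.mul_mem_left c hy) (by rw [← hxy]; ring)⟩

/-- If `z` generates `I` over its endomorphism ring, then `I ^ 2 = z I`. -/
theorem mul_self_eq_span_singleton_mul {I : Ideal V} {z : V} (hz : z ∈ I)
    (h : ∀ y ∈ I, ∃ s ∉ nonStabilizer I, z ∣ s * y) : I * I = Ideal.span {z} * I := by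
  apply le_antisymm
  · rw [Ideal.mul_le]
    intro y hy x hx
    obtain ⟨s, hs, t, ht⟩ := h y hy
    obtain ⟨w, hw, rfl⟩ := exists_mul_eq_of_notMem_nonStabilizer hs hx
    rw [show y * (s * w) = z * (t * w) by linear_combination w * ht]
    exact Ideal.mem_span_singleton_mul.mpr ⟨_, I.mul_mem_left t hw, rfl⟩
  · exact Ideal.mul_mono_left ((Ideal.span_singleton_le_iff_mem I).mpr hz)

variable [IsDomain V]

/-- The prime ideal of elements `p` of a valuation ring with `p I ≠ I`. -/
def nonStabilizerIdeal [ValuationRing V] (I : Ideal V) (hI : I ≠ ⊥) : Ideal V where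
  carrier := nonStabilizer I
  zero_mem' := zero_mem_nonStabilizer hI
  smul_mem' c _ hp := mul_mem_nonStabilizer hp c
  add_mem' := by
    intro p q hp hq
    obtain ⟨c, rfl | rfl⟩ := ValuationRing.cond p q
    · rw [show p + p * c = (1 + c) * p by ring]
      exact mul_mem_nonStabilizer hp _
    · rw [show q * c + q = (1 + c) * q by ring]
      exact mul_mem_nonStabilizer hq _

theorem mem_nonStabilizerIdeal [ValuationRing V] {I : Ideal V} {hI : I ≠ ⊥} {p : V} :
    p ∈ nonStabilizerIdeal I hI ↔ p ∈ nonStabilizer I := Iff.rfl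

theorem nonStabilizerIdeal_isPrime [ValuationRing V] (I : Ideal V) (hI : I ≠ ⊥) :
    (nonStabilizerIdeal I hI).IsPrime := by
  refine ⟨fun h => one_notMem_nonStabilizer I ?_, fun {p q} hpq => ?_⟩
  · rw [← mem_nonStabilizerIdeal (hI := hI), h]
    trivial
  · by_contra! h
    obtain ⟨x, hx, hpq⟩ := hpq
    obtain ⟨y, hy, rfl⟩ := exists_mul_eq_of_notMem_nonStabilizer h.1 hx
    obtain ⟨z, hz, rfl⟩ := exists_mul_eq_of_notMem_nonStabilizer h.2 hy
    exact hpq z hz (mul_assoc p q z)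

theorem ne_zero_of_forall_dvd_mul {I : Ideal V} (hI : I ≠ ⊥) {z : V}
    (h : ∀ y ∈ I, ∃ s ∉ nonStabilizer I, z ∣ s * y) : z ≠ 0 := by
  rintro rfl
  obtain ⟨x, hx, hx0⟩ := (Submodule.ne_bot_iff I).mp hI
  obtain ⟨s, hs, hsx⟩ := h x hx
  rcases mul_eq_zero.mp (zero_dvd_iff.mp hsx) with h0 | h0
  · exact hs (h0 ▸ zero_mem_nonStabilizer hI)
  · exact hx0 h0

variable [ValuationRing V]

/-- Comparability: an `x ∈ I` outside `pI` divides every element of `pI`, since otherwise `x` would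
be a multiple of an element of `pI`. -/
theorem exists_dvd_mul_of_mem_nonStabilizer {I : Ideal V} {p : V} (hp : p ∈ nonStabilizer I) :
    ∃ x ∈ I, x ≠ 0 ∧ ∀ y ∈ I, x ∣ p * y := by
  obtain ⟨x, hx, h⟩ := hp
  refine ⟨x, hx, ?_, fun y hy => ?_⟩
  · rintro rfl
    exact h 0 I.zero_mem (mul_zero p)
  · obtain ⟨c, hc | hc⟩ := ValuationRing.cond x (p * y)
    · exact ⟨c, hc.symm⟩
    · exact (h (c * y) (I.mul_mem_left c hy) (by rw [← hc]; ring)).elim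

/-- An element of `I` generates `I` over the endomorphism ring unless it lies in `I P`. -/
theorem forall_dvd_mul_or_exists_eq_mul {I : Ideal V} (z : V) :
    (∀ y ∈ I, ∃ s ∉ nonStabilizer I, z ∣ s * y) ∨ ∃ y ∈ I, ∃ q ∈ nonStabilizer I, z = q * y := by
  by_contra! h
  obtain ⟨⟨y, hy, h1⟩, h2⟩ := h
  obtain ⟨c, hc | hc⟩ := ValuationRing.cond z y
  · exact h1 1 (one_notMem_nonStabilizer I) ⟨c, by rw [hc, one_mul]⟩
  · by_cases hcP : c ∈ nonStabilizer I
    · exact h2 y hy c hcP (by rw [← hc, mul_comm])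
    · exact h1 c hcP ⟨1, by rw [← hc]; ring⟩

/-- Let `P` be the prime of nonstabilizers. If some `z` generates `I` over its endomorphism ring,
`I² = zI`. Otherwise every element of `I` lies in `PI`, and `J = (I : I²)`, scaled into `V`, works.
-/
theorem ValuationRing.isCliffordRegular : IsCliffordRegular V := by
  rw [isCliffordRegular_iff_ideal]
  intro I hI
  by_cases hgen : ∃ z ∈ I, ∀ y ∈ I, ∃ s ∉ nonStabilizer I, z ∣ s * y
  · obtain ⟨z, hz, h⟩ := hgen
    exact ⟨⊤, z, ne_zero_of_forall_dvd_mul hI h, by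
      rw [Ideal.mul_top, mul_self_eq_span_singleton_mul hz h]⟩
  · obtain ⟨b, hb, hb0⟩ := (Submodule.ne_bot_iff I).mp hI
    -- The factor `b²` with `b ∈ I` makes `b²(I : I²)` an integral ideal.
    refine ⟨(Ideal.span {b * b} * I).colon ((I * I : Ideal V) : Set V), b * b,
      mul_ne_zero hb0 hb0, le_antisymm ?_ ?_⟩
    · rw [Ideal.mul_le]
      intro x hx j hj
      rw [mul_comm x]
      exact Submodule.mem_colon.mp hj x hx
    · intro w hw
      obtain ⟨x, hx, rfl⟩ := Ideal.mem_span_singleton_mul.mp hw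
      have hxgen : ¬ ∀ y ∈ I, ∃ s ∉ nonStabilizer I, x ∣ s * y := fun h => hgen ⟨x, hx, h⟩
      obtain ⟨x', hx', p, hp, rfl⟩ := (forall_dvd_mul_or_exists_eq_mul x).resolve_left hxgen
      obtain ⟨y, hy, hy0, hdvd⟩ := exists_dvd_mul_of_mem_nonStabilizer hp
      obtain ⟨c, hc⟩ := hdvd b hb
      -- Here `bc = b²p/y`, and `(p/y)I ⊆ V` because `y` divides `pI`; hence `bc` carries `I²` into
      -- `b²I`.
      rw [show b * b * (p * x') = x' * y * (b * c) by linear_combination b * x' * hc]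
      refine Ideal.mul_mem_mul (Ideal.mul_mem_mul hx' hy) (Submodule.mem_colon.mpr ?_)
      intro r hr
      refine Submodule.mul_induction_on hr (fun u hu v hv => ?_) fun u v hu hv => ?_
      · obtain ⟨d, hd⟩ := hdvd u hu
        refine Ideal.mem_span_singleton_mul.mpr ⟨d * v, I.mul_mem_left d hv, ?_⟩
        apply mul_left_cancel₀ hy0
        simp only [smul_eq_mul]
        linear_combination b * u * v * hc - b * b * v * hd
      · rw [smul_add]
        exact Ideal.add_mem _ hu hv

/-- Over a strongly discrete valuation ring every nonzero ideal is principal over its endomorphism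
ring. -/
theorem exists_mul_self_eq_span_singleton_mul (hV : IsStronglyDiscrete V) {I : Ideal V}
    (hI : I ≠ ⊥) : ∃ z, z ≠ 0 ∧ I * I = Ideal.span {z} * I := by
  suffices ∃ z ∈ I, ∀ y ∈ I, ∃ s ∉ nonStabilizer I, z ∣ s * y by
    obtain ⟨z, hz, h⟩ := this
    exact ⟨z, ne_zero_of_forall_dvd_mul hI h, mul_self_eq_span_singleton_mul hz h⟩
  set P := nonStabilizerIdeal I hI with hP
  by_cases hbot : P = ⊥
  · obtain ⟨z, hz, hz0⟩ := (Submodule.ne_bot_iff I).mp hI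
    refine ⟨z, hz, fun y _ => ⟨z, fun h => hz0 ?_, dvd_mul_right z y⟩⟩
    exact (Submodule.mem_bot V).mp (hbot ▸ (mem_nonStabilizerIdeal (hI := hI)).mpr h)
  · have hPP := hV P (nonStabilizerIdeal_isPrime I hI) hbot
    -- Choose `x ∈ I` dividing `pI`. If `x` is not a generator, then `x = qy` with `q ∈ P` and `p =
    -- qc`; as `p ∉ P²`, `c ∉ P`, and `y` divides `cI`, so `y` is a generator.
    obtain ⟨p, hp, hpP⟩ : ∃ p ∈ P, p ∉ P * P := by
      by_contra! h
      exact hPP (le_antisymm Ideal.mul_le_left h)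
    obtain ⟨x, hx, hx0, hdvd⟩ := exists_dvd_mul_of_mem_nonStabilizer
      (mem_nonStabilizerIdeal.mp hp)
    rcases forall_dvd_mul_or_exists_eq_mul (I := I) x with h | ⟨y, hy, q, hq, rfl⟩
    · exact ⟨x, hx, h⟩
    · obtain ⟨c, hc⟩ := hdvd y hy
      have hy0 : y ≠ 0 := right_ne_zero_of_mul hx0
      have hpq : p = q * c := mul_right_cancel₀ hy0 (by rw [hc]; ring)
      refine ⟨y, hy, fun y' hy' => ⟨c, fun hcP => hpP ?_, ?_⟩⟩
      · rw [hpq]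
        exact Ideal.mul_mem_mul hq hcP
      · obtain ⟨d, hd⟩ := hdvd y' hy'
        refine ⟨d, mul_left_cancel₀ (left_ne_zero_of_mul hx0) ?_⟩
        linear_combination hd - y' * hpq

end ValuationRing

/-! ### Passage between `T` and its residue field -/

section Pullback

variable {T K : Type*} [CommRing T] [Field K]

/-- The preimage in `T` of a `D`-submodule of `K`, as a module over the pullback. -/
def pullbackSubmodule (φ : T →+* K) {D : Subring K} (W : Submodule D K) :
    Submodule (D.comap φ) T where
  carrier := {t | φ t ∈ W}
  zero_mem' := by simp
  add_mem' := by
    intro a b ha hb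
    simpa using W.add_mem ha hb
  smul_mem' := by
    intro s t ht
    have := W.smul_mem (⟨φ s, s.2⟩ : D) ht
    simpa [Subring.smul_def] using this

theorem mem_pullbackSubmodule {φ : T →+* K} {D : Subring K} {W : Submodule D K} {t : T} :
    t ∈ pullbackSubmodule φ W ↔ φ t ∈ W := Iff.rfl

/-- The image in `K` of a submodule of `T` over the pullback, as a `D`-module. -/
def residueSubmodule {φ : T →+* K} (hφ : Function.Surjective φ) {D : Subring K}
    (N : Submodule (D.comap φ) T) : Submodule D K where
  carrier := φ '' N
  zero_mem' := ⟨0, N.zero_mem, map_zero φ⟩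
  add_mem' := by
    rintro _ _ ⟨a, ha, rfl⟩ ⟨b, hb, rfl⟩
    exact ⟨a + b, N.add_mem ha hb, map_add φ a b⟩
  smul_mem' := by
    rintro ⟨d, hd⟩ _ ⟨a, ha, rfl⟩
    obtain ⟨s, rfl⟩ := hφ d
    exact ⟨s * a, N.smul_mem (⟨s, hd⟩ : D.comap φ) ha, map_mul φ s a⟩

variable {φ : T →+* K} (hφ : Function.Surjective φ) {D : Subring K}

theorem mem_residueSubmodule {N : Submodule (D.comap φ) T} {x : K} :
    x ∈ residueSubmodule hφ N ↔ ∃ t ∈ N, φ t = x := Iff.rfl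

theorem residueSubmodule_pullbackSubmodule (W : Submodule D K) :
    residueSubmodule hφ (pullbackSubmodule φ W) = W := by
  ext x
  rw [mem_residueSubmodule]
  constructor
  · rintro ⟨t, ht, rfl⟩
    exact ht
  · intro hx
    obtain ⟨t, rfl⟩ := hφ x
    exact ⟨t, hx, rfl⟩

theorem residueSubmodule_mul (N L : Submodule (D.comap φ) T) :
    residueSubmodule hφ (N * L) = residueSubmodule hφ N * residueSubmodule hφ L := by
  apply le_antisymm
  · rintro _ ⟨t, ht, rfl⟩
    refine Submodule.mul_induction_on ht (fun a ha b hb => ?_) fun a b ha hb => ?_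
    · rw [map_mul]
      exact Submodule.mul_mem_mul ⟨a, ha, rfl⟩ ⟨b, hb, rfl⟩
    · rw [map_add]
      exact Submodule.add_mem _ ha hb
  · rw [Submodule.mul_le]
    rintro _ ⟨a, ha, rfl⟩ _ ⟨b, hb, rfl⟩
    exact ⟨a * b, Submodule.mul_mem_mul ha hb, map_mul φ a b⟩

theorem residueSubmodule_span_singleton_mul (a : T) (N : Submodule (D.comap φ) T) :
    residueSubmodule hφ (Submodule.span (D.comap φ) {a} * N) =
      Submodule.span D {φ a} * residueSubmodule hφ N := by
  ext x
  rw [mem_residueSubmodule, mem_span_singleton_mul_submodule]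
  constructor
  · rintro ⟨t, ht, rfl⟩
    obtain ⟨y, hy, rfl⟩ := mem_span_singleton_mul_submodule.mp ht
    exact ⟨φ y, ⟨y, hy, rfl⟩, (map_mul φ a y).symm⟩
  · rintro ⟨_, ⟨y, hy, rfl⟩, rfl⟩
    exact ⟨a * y, mem_span_singleton_mul_submodule.mpr ⟨y, hy, rfl⟩, map_mul φ a y⟩

end Pullback

/-! ### Extension and restriction of scalars between a ring and an algebra over it -/

section Extension

variable {S T : Type*} [CommRing S] [CommRing T] [Algebra S T]

theorem Ideal.span_coe_submodule_mul (N L : Submodule S T) :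
    Ideal.span ((N * L : Submodule S T) : Set T) =
      Ideal.span (N : Set T) * Ideal.span (L : Set T) := by
  rw [Ideal.span_mul_span', Submodule.mul_eq_span_mul_set]
  exact Submodule.span_span_of_tower S T _

theorem Ideal.span_coe_span_singleton (a : T) :
    Ideal.span ((Submodule.span S {a} : Submodule S T) : Set T) = Ideal.span {a} :=
  Submodule.span_span_of_tower S T _

theorem Ideal.span_coe_restrictScalars (I : Ideal T) :
    Ideal.span ((I.restrictScalars S : Submodule S T) : Set T) = I :=
  Submodule.span_eq I

theorem restrictScalars_ideal_mul (I J : Ideal T) :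
    (I * J).restrictScalars S = I.restrictScalars S * J.restrictScalars S :=
  Submodule.restrictScalars_mul ..

theorem restrictScalars_span_singleton_mul (a : T) (I : Ideal T) :
    (Ideal.span {a} * I).restrictScalars S =
      Submodule.span S {a} * I.restrictScalars S := by
  ext x
  rw [mem_span_singleton_mul_submodule, Submodule.restrictScalars_mem, Ideal.mem_span_singleton_mul]
  rfl

end Extension

/-! ### What regularity of the pullback implies over `T` and over `K` -/

section RegularPullback

variable {T K : Type*} [CommRing T] [Field K] {φ : T →+* K} {D : Subring K}

theorem mem_comap_of_mem_ker {t : T} (ht : φ t = 0) : t ∈ D.comap φ := by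
  rw [Subring.mem_comap, ht]
  exact D.zero_mem

theorem algebraMap_comap_injective : Function.Injective (algebraMap (D.comap φ) T) :=
  Subtype.coe_injective

theorem exists_mem_ker_ne_zero {M : Ideal T} (hM0 : M ≠ ⊥) (hker : RingHom.ker φ = M) :
    ∃ m : D.comap φ, m ≠ 0 ∧ φ m = 0 := by
  obtain ⟨m, hm, hm0⟩ := (Submodule.ne_bot_iff M).mp hM0
  have hφm : φ m = 0 := by rwa [← hker, RingHom.mem_ker] at hm
  exact ⟨⟨m, mem_comap_of_mem_ker hφm⟩, fun h => hm0 (congrArg Subtype.val h), hφm⟩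

theorem exists_algebraMap_eq_mul {m : D.comap φ} (hm : φ m = 0) (x : T) :
    ∃ y : D.comap φ, algebraMap (D.comap φ) T y = algebraMap (D.comap φ) T m * x :=
  ⟨⟨m * x, mem_comap_of_mem_ker (by rw [map_mul, hm, zero_mul])⟩, rfl⟩

/-- The preimage of `W ≠ 0` strictly contains the maximal ideal `M`. -/
theorem span_pullbackSubmodule_eq_top {M : Ideal T} (hM : M.IsMaximal)
    (hφ : Function.Surjective φ) (hker : RingHom.ker φ = M) {W : Submodule D K} (hW : W ≠ ⊥) :
    Ideal.span (pullbackSubmodule φ W : Set T) = ⊤ := by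
  obtain ⟨w, hw, hw0⟩ := (Submodule.ne_bot_iff W).mp hW
  obtain ⟨t, rfl⟩ := hφ w
  refine hM.out.2 _ (lt_of_le_of_ne (fun x hx => Ideal.subset_span ?_) fun h => hw0 ?_)
  · rw [← hker, RingHom.mem_ker] at hx
    rw [SetLike.mem_coe, mem_pullbackSubmodule, hx]
    exact W.zero_mem
  · rw [← RingHom.mem_ker, hker, h]
    exact Ideal.subset_span hw

theorem pullbackSubmodule_ne_bot (hφ : Function.Surjective φ) {W : Submodule D K} (hW : W ≠ ⊥) :
    pullbackSubmodule φ W ≠ ⊥ := by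
  obtain ⟨w, hw, hw0⟩ := (Submodule.ne_bot_iff W).mp hW
  obtain ⟨t, rfl⟩ := hφ w
  exact (Submodule.ne_bot_iff _).mpr ⟨t, hw, by rintro rfl; simp at hw0⟩

variable [IsDomain T]

theorem IsCliffordRegular.of_comap (h : IsCliffordRegular (D.comap φ)) {M : Ideal T}
    (hM0 : M ≠ ⊥) (hker : RingHom.ker φ = M) : IsCliffordRegular T := by
  obtain ⟨m, hm0, hm⟩ := exists_mem_ker_ne_zero (D := D) hM0 hker
  rw [isCliffordRegular_iff_ideal]
  intro I hI
  obtain ⟨J, a, ha, hJ⟩ := h.exists_submodule algebraMap_comap_injective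
    (N := I.restrictScalars (D.comap φ)) (by simpa using hI) hm0
    fun x _ => exists_algebraMap_eq_mul hm x
  refine ⟨Ideal.span J, a, ha, ?_⟩
  have := congrArg (fun N : Submodule (D.comap φ) T => Ideal.span (N : Set T)) hJ
  simpa only [Ideal.span_coe_submodule_mul, Ideal.span_coe_span_singleton,
    Ideal.span_coe_restrictScalars] using this

theorem IsBooleRegular.of_comap (h : IsBooleRegular (D.comap φ)) {M : Ideal T}
    (hM0 : M ≠ ⊥) (hker : RingHom.ker φ = M) : IsBooleRegular T := by
  obtain ⟨m, hm0, hm⟩ := exists_mem_ker_ne_zero (D := D) hM0 hker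
  rw [isBooleRegular_iff_ideal]
  intro I hI
  obtain ⟨a, b, ha, hb, hJ⟩ := h.exists_submodule algebraMap_comap_injective
    (N := I.restrictScalars (D.comap φ)) (by simpa using hI) hm0
    fun x _ => exists_algebraMap_eq_mul hm x
  refine ⟨a, b, ha, hb, ?_⟩
  have := congrArg (fun N : Submodule (D.comap φ) T => Ideal.span (N : Set T)) hJ
  simpa only [Ideal.span_coe_submodule_mul, Ideal.span_coe_span_singleton,
    Ideal.span_coe_restrictScalars] using this

/-- If the pullback is Clifford regular, then the multiplicative semigroup of nonzero
`D`-submodules of `K` is von Neumann regular. -/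
theorem IsCliffordRegular.exists_mul_mul_eq (h : IsCliffordRegular (D.comap φ)) {M : Ideal T}
    (hM : M.IsMaximal) (hM0 : M ≠ ⊥) (hφ : Function.Surjective φ) (hker : RingHom.ker φ = M)
    {W : Submodule D K} (hW : W ≠ ⊥) : ∃ B : Submodule D K, W * W * B = W := by
  obtain ⟨m, hm0, hm⟩ := exists_mem_ker_ne_zero (D := D) hM0 hker
  obtain ⟨J, a, ha, hJ⟩ := h.exists_submodule algebraMap_comap_injective
    (pullbackSubmodule_ne_bot hφ hW) hm0 fun x _ => exists_algebraMap_eq_mul hm x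
  have hE := congrArg (fun N : Submodule (D.comap φ) T => Ideal.span (N : Set T)) hJ
  simp only [Ideal.span_coe_submodule_mul, Ideal.span_coe_span_singleton,
    span_pullbackSubmodule_eq_top hM hφ hker hW, Ideal.mul_top, Ideal.top_mul] at hE
  -- Since `JT = aT`, every element of `J` is divisible by `a` in `T`.
  obtain ⟨J', rfl⟩ : ∃ J', J = Submodule.span (D.comap φ) {a} * J' := by
    refine ⟨J.comap (LinearMap.mulLeft (D.comap φ) a), ?_⟩
    ext x
    rw [mem_span_singleton_mul_submodule]
    constructor
    · intro hx
      obtain ⟨y, rfl⟩ : a ∣ x := by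
        rw [← Ideal.mem_span_singleton, ← hE]
        exact Ideal.subset_span hx
      exact ⟨y, hx, rfl⟩
    · rintro ⟨y, hy, rfl⟩
      exact hy
  rw [mul_left_comm] at hJ
  have hJ' := congrArg (residueSubmodule hφ) (span_singleton_mul_right_injective ha hJ)
  simp only [residueSubmodule_mul, residueSubmodule_pullbackSubmodule] at hJ'
  exact ⟨_, hJ'⟩

/-- If the pullback is Boole regular, then every nonzero `D`-submodule of `K` is idempotent up to a
scalar. -/
theorem IsBooleRegular.exists_mul_eq (h : IsBooleRegular (D.comap φ)) {M : Ideal T}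
    (hM : M.IsMaximal) (hM0 : M ≠ ⊥) (hφ : Function.Surjective φ) (hker : RingHom.ker φ = M)
    {W : Submodule D K} (hW : W ≠ ⊥) : ∃ c : K, c ≠ 0 ∧ W * W = Submodule.span D {c} * W := by
  obtain ⟨m, hm0, hm⟩ := exists_mem_ker_ne_zero (D := D) hM0 hker
  obtain ⟨a, b, ha, hb, hJ⟩ := h.exists_submodule algebraMap_comap_injective
    (pullbackSubmodule_ne_bot hφ hW) hm0 fun x _ => exists_algebraMap_eq_mul hm x
  have hE := congrArg (fun N : Submodule (D.comap φ) T => Ideal.span (N : Set T)) hJ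
  simp only [Ideal.span_coe_submodule_mul, Ideal.span_coe_span_singleton,
    span_pullbackSubmodule_eq_top hM hφ hker hW, Ideal.mul_top] at hE
  -- From `aT = bT`, `b = au` with `u` a unit of `T`; the scalar in `K` is `φ u`.
  obtain ⟨u, rfl⟩ := Ideal.span_singleton_eq_span_singleton.mp hE
  rw [← span_singleton_mul_span_singleton', mul_assoc] at hJ
  have hJ' := congrArg (residueSubmodule hφ) (span_singleton_mul_right_injective ha hJ)
  rw [residueSubmodule_span_singleton_mul, residueSubmodule_mul,
    residueSubmodule_pullbackSubmodule] at hJ'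
  exact ⟨φ u, (u.isUnit.map φ).ne_zero, hJ'⟩

end RegularPullback

/-! ### Submodules of `K`: regularity of `D` and the degree bound -/

section Residue

variable {K : Type*} [Field K] {D : Subring K}

theorem idealImage_subring_ne_bot {J : Ideal D} (hJ : J ≠ ⊥) : idealImage K J ≠ ⊥ := by
  obtain ⟨j, hj, hj0⟩ := (Submodule.ne_bot_iff J).mp hJ
  exact (Submodule.ne_bot_iff _).mpr
    ⟨j, mem_idealImage.mpr ⟨j, hj, rfl⟩, fun h => hj0 (Subtype.ext h)⟩

theorem isCliffordRegular_of_forall_exists_mul_mul_eq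
    (h : ∀ W : Submodule D K, W ≠ ⊥ → ∃ B : Submodule D K, W * W * B = W) :
    IsCliffordRegular D := by
  rw [isCliffordRegular_iff_ideal]
  intro I hI
  obtain ⟨B, hB⟩ := h _ (idealImage_subring_ne_bot hI)
  obtain ⟨j, hj, hj0⟩ := (Submodule.ne_bot_iff I).mp hI
  have hjI : algebraMap D K j ∈ idealImage K I := mem_idealImage.mpr ⟨j, hj, rfl⟩
  -- With `j ∈ I`, `j²B ⊆ I²B = I`, so `j²` clears the denominators of `B`.
  obtain ⟨J, hJ⟩ := exists_idealImage_eq_span_singleton_mul (N := B) (m := j * j) fun x hx => by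
    have := Submodule.mul_mem_mul (Submodule.mul_mem_mul hjI hjI) hx
    rw [hB] at this
    obtain ⟨y, -, hy⟩ := mem_idealImage.mp this
    exact ⟨y, by rw [hy, map_mul]⟩
  refine ⟨J, j * j, mul_ne_zero hj0 hj0, idealImage_injective (F := K) Subtype.coe_injective ?_⟩
  rw [idealImage_mul, idealImage_mul, idealImage_mul, idealImage_span_singleton, hJ,
    mul_left_comm, hB]

theorem isBooleRegular_of_forall_exists_mul_eq
    (h : ∀ W : Submodule D K, W ≠ ⊥ → ∃ c : K, c ≠ 0 ∧ W * W = Submodule.span D {c} * W) :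
    IsBooleRegular D := by
  rw [isBooleRegular_iff_ideal]
  intro I hI
  obtain ⟨c, hc, hW⟩ := h _ (idealImage_subring_ne_bot hI)
  obtain ⟨j, hj, hj0⟩ := (Submodule.ne_bot_iff I).mp hI
  have hjI : algebraMap D K j ∈ idealImage K I := mem_idealImage.mpr ⟨j, hj, rfl⟩
  have hj0' : algebraMap D K j ≠ 0 := fun h => hj0 (Subtype.ext h)
  -- Thus `cj ∈ I² ⊆ D`, and `c` is a fraction `d/j` over `D`.
  have hcj : c * algebraMap D K j ∈ idealImage K I * idealImage K I := by
    rw [hW]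
    exact mem_span_singleton_mul_submodule.mpr ⟨_, hjI, rfl⟩
  rw [← idealImage_mul] at hcj
  obtain ⟨d, -, hd⟩ := mem_idealImage.mp hcj
  refine ⟨j, d, hj0, ?_, idealImage_injective (F := K) Subtype.coe_injective ?_⟩
  · rintro rfl
    rw [map_zero, eq_comm] at hd
    exact mul_ne_zero hc hj0' hd
  · rw [idealImage_mul, idealImage_mul, idealImage_mul, idealImage_span_singleton,
      idealImage_span_singleton, hW, hd, ← span_singleton_mul_span_singleton']
    ring

theorem subring_le_quotientFieldIn {x : K} (hx : x ∈ D) : x ∈ quotientFieldIn D :=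
  Subfield.subset_closure hx

theorem exists_mul_eq_of_finiteDimensional {k : Subfield K} {V : Submodule k K}
    [FiniteDimensional k V] {b : K} (hb : b ≠ 0) (h : ∀ x ∈ V, b * x ∈ V) {y : K} (hy : y ∈ V) :
    ∃ x ∈ V, b * x = y := by
  have hinj : Function.Injective ((LinearMap.mulLeft k b).restrict h) := by
    intro x y hxy
    exact Subtype.ext (mul_left_cancel₀ hb (congrArg Subtype.val hxy))
  obtain ⟨x, hx⟩ := LinearMap.injective_iff_surjective.mp hinj ⟨y, hy⟩
  exact ⟨x, x.2, congrArg Subtype.val hx⟩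

/-- Finite-dimensional subspaces containing `1` are fields if the `D`-submodules of `K` form a von
Neumann regular semigroup. -/
theorem mul_mem_of_forall_exists_mul_mul_eq
    (h : ∀ W : Submodule D K, W ≠ ⊥ → ∃ B : Submodule D K, W * W * B = W)
    {V : Submodule (quotientFieldIn D) K} [FiniteDimensional (quotientFieldIn D) V]
    (h1 : (1 : K) ∈ V) {x y : K} (hx : x ∈ V) (hy : y ∈ V) : x * y ∈ V := by
  let W : Submodule D K :=
    { carrier := V
      zero_mem' := V.zero_mem
      add_mem' := V.add_mem
      smul_mem' := fun d x hx =>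
        V.smul_mem (⟨d, subring_le_quotientFieldIn d.2⟩ : quotientFieldIn D) hx }
  have hW : W ≠ ⊥ := (Submodule.ne_bot_iff W).mpr ⟨1, h1, one_ne_zero⟩
  obtain ⟨B, hB⟩ := h W hW
  obtain ⟨b, hb, hb0⟩ : ∃ b ∈ B, b ≠ 0 := by
    rw [← Submodule.ne_bot_iff]
    rintro rfl
    rw [Submodule.mul_bot] at hB
    exact hW hB.symm
  have key : ∀ u ∈ V, ∀ v ∈ V, u * v * b ∈ V := by
    intro u hu v hv
    change u * v * b ∈ W
    rw [← hB]
    exact Submodule.mul_mem_mul (Submodule.mul_mem_mul hu hv) hb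
  -- As `1 ∈ V`, `bV ⊆ V`, so `bV = V` by dimension; writing `x = bz` puts `xy = zyb` in `V²b ⊆ V`.
  obtain ⟨z, hz, rfl⟩ := exists_mul_eq_of_finiteDimensional hb0
    (fun u hu => by simpa [mul_comm] using key u hu 1 h1) hx
  rw [show b * z * y = z * y * b by ring]
  exact key z hz y hy

/-- For `u ∉ k` and any `v`, the span of `1, u, v` is closed under products, so `uv = a + bu + cv`
and `(u - c)v = a + bu`. Multiplication by `u - c ≠ 0` is bijective on `k + ku`, so `v ∈ k + ku`. -/
theorem rank_le_two_of_forall_exists_mul_mul_eq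
    (h : ∀ W : Submodule D K, W ≠ ⊥ → ∃ B : Submodule D K, W * W * B = W) :
    Module.rank (quotientFieldIn D) K ≤ 2 := by
  set k := quotientFieldIn D with hk
  suffices ∃ u : K, Submodule.span k {1, u} = ⊤ by
    obtain ⟨u, hu⟩ := this
    classical
    have := rank_span_finset_le (R := k) (M := K) {1, u}
    rw [Finset.coe_pair, hu, rank_top] at this
    exact this.trans (by exact_mod_cast Finset.card_le_two)
  by_cases hu : ∃ u : K, u ∉ k
  · obtain ⟨u, hu⟩ := hu
    refine ⟨u, Submodule.eq_top_iff'.mpr fun v => ?_⟩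
    have : FiniteDimensional k (Submodule.span k {1, u}) :=
      FiniteDimensional.span_of_finite k (Set.toFinite _)
    have : FiniteDimensional k (Submodule.span k {1, u, v}) :=
      FiniteDimensional.span_of_finite k (Set.toFinite _)
    have huv : u * v ∈ Submodule.span k {1, u, v} :=
      mul_mem_of_forall_exists_mul_mul_eq h (Submodule.subset_span (by simp))
        (Submodule.subset_span (by simp)) (Submodule.subset_span (by simp))
    obtain ⟨a, b, c, habc⟩ := Submodule.mem_span_triple.mp huv
    simp only [Subfield.smul_def, smul_eq_mul, mul_one] at habc
    have hone : (1 : K) ∈ Submodule.span k {1, u} := Submodule.subset_span (by simp)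
    have hu' : u ∈ Submodule.span k {1, u} := Submodule.subset_span (by simp)
    have hc : u - c ≠ 0 := fun h0 => hu (by rw [sub_eq_zero.mp h0]; exact c.2)
    have hcmem : ∀ r : k, (r : K) ∈ Submodule.span k {1, u} := fun r => by
      simpa [Subfield.smul_def] using Submodule.smul_mem _ r hone
    obtain ⟨w, hw, hw'⟩ := exists_mul_eq_of_finiteDimensional (V := Submodule.span k {1, u}) hc
      (fun x hx => mul_mem_of_forall_exists_mul_mul_eq h hone
        (Submodule.sub_mem _ hu' (hcmem c)) hx)
      (Submodule.add_mem _ (hcmem a) (Submodule.smul_mem _ b hu'))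
    have : v = w := by
      apply mul_left_cancel₀ hc
      rw [hw']
      simp only [Subfield.smul_def, smul_eq_mul]
      linear_combination -habc
    rwa [this]
  · push Not at hu
    refine ⟨1, Submodule.eq_top_iff'.mpr fun v => ?_⟩
    have := Submodule.smul_mem (Submodule.span k {1, (1 : K)}) (⟨v, hu v⟩ : k)
      (Submodule.subset_span (by simp : (1 : K) ∈ _))
    simpa [Subfield.smul_def] using this

end Residue

/-! ### Quadratic residue extensions of valuation rings -/

section QuadraticPullback

variable {K : Type*} [Field K]

theorem exists_eq_add_mul_of_rank_eq_two {k : Subfield K} (h : Module.rank k K = 2) {s : K}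
    (hs : s ∉ k) (t : K) : ∃ a ∈ k, ∃ b ∈ k, t = a + b * s := by
  have hli : LinearIndependent k ![(1 : K), s] := by
    rw [LinearIndependent.pair_iff]
    intro a b hab
    simp only [Subfield.smul_def, smul_eq_mul, mul_one] at hab
    have hb : b = 0 := by
      by_contra hb
      have hb' : (b : K) ≠ 0 := by simpa using hb
      apply hs
      rw [show s = -a / b by field_simp; linear_combination hab]
      exact k.div_mem (k.neg_mem a.2) b.2
    refine ⟨?_, hb⟩
    simpa [hb] using hab
  have hfin : Module.finrank k K = 2 := by
    rw [Module.finrank, h]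
    simp
  have : FiniteDimensional k K := FiniteDimensional.of_finrank_pos (by rw [hfin]; norm_num)
  have htop := hli.span_eq_top_of_card_eq_finrank (by simp [hfin])
  have ht : t ∈ Submodule.span k (Set.range ![(1 : K), s]) := htop ▸ Submodule.mem_top
  rw [Matrix.range_cons_cons_empty, Submodule.mem_span_pair] at ht
  obtain ⟨a, b, hab⟩ := ht
  refine ⟨a, a.2, b, b.2, ?_⟩
  simpa [Subfield.smul_def] using hab.symm

theorem rank_eq_two_of_le {k : Subfield K} (hk : ∃ s, s ∉ k) (h : Module.rank k K ≤ 2) :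
    Module.rank k K = 2 := by
  obtain ⟨s, hs⟩ := hk
  have h1 : ¬ Module.rank k K ≤ 1 := by
    intro h1
    obtain ⟨v, hv⟩ := rank_le_one_iff.mp h1
    obtain ⟨r, hr⟩ := hv 1
    obtain ⟨r', hr'⟩ := hv s
    simp only [Subfield.smul_def, smul_eq_mul] at hr hr'
    have hv' : v = (r : K)⁻¹ := eq_inv_of_mul_eq_one_right hr
    apply hs
    rw [← hr', hv']
    exact k.mul_mem r'.2 (k.inv_mem r.2)
  obtain ⟨n, hn⟩ := Cardinal.lt_aleph0.mp (h.trans_lt (Cardinal.natCast_lt_aleph0 (n := 2)))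
  rw [hn] at h h1 ⊢
  norm_cast at h h1 ⊢
  lia

variable {T : Type*} [CommRing T] [IsDomain T] {φ : T →+* K} {D : Subring K}

/-- Over a quadratic pullback in a valuation ring, an ideal is either an ideal of the valuation
ring or principal. -/
theorem isPrincipal_or_exists_restrictScalars_eq [ValuationRing T] {M : Ideal T}
    (hM : M.IsMaximal) (hφ : Function.Surjective φ) (hker : RingHom.ker φ = M)
    (hD : ∀ s ∉ D, ∀ t, ∃ a ∈ D, ∃ b ∈ D, t = a + b * s) (I : Ideal (D.comap φ)) :
    (∃ x, I = Ideal.span {x}) ∨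
      ∃ I' : Ideal T, idealImage T I = I'.restrictScalars (D.comap φ) := by
  by_cases hI : ∀ t : T, ∀ x ∈ idealImage T I, t * x ∈ idealImage T I
  · exact Or.inr ⟨{ idealImage T I with smul_mem' := fun t x hx => hI t x hx }, rfl⟩
  left
  push Not at hI
  obtain ⟨t, _, ⟨x, hx, rfl⟩, htx⟩ := hI
  replace htx : t * (x : T) ∉ idealImage T I := htx
  have hmul : ∀ {s y : T}, s ∈ D.comap φ → y ∈ idealImage T I → s * y ∈ idealImage T I :=
    fun {s y} hs hy => (idealImage T I).smul_mem (⟨s, hs⟩ : D.comap φ) hy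
  refine ⟨x, le_antisymm (fun y hy => ?_) ((Ideal.span_singleton_le_iff_mem I).mpr hx)⟩
  have hxI : (x : T) ∈ idealImage T I := ⟨x, hx, rfl⟩
  have hyI : (y : T) ∈ idealImage T I := ⟨y, hy, rfl⟩
  -- If instead `x = yc` with `c ∈ M`, then `tx = (tc)y` with `tc ∈ M ⊆ R`, forcing `tx ∈ I`. So `c`
  -- is a unit and `x` divides `y` anyway.
  obtain ⟨s, hs⟩ : (x : T) ∣ y := by
    obtain ⟨c, hc | hc⟩ := ValuationRing.cond (x : T) y
    · exact ⟨c, hc.symm⟩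
    · by_cases hcM : c ∈ M
      · refine (htx ?_).elim
        rw [← hc, show t * (y * c) = t * c * y by ring]
        refine hmul (mem_comap_of_mem_ker ?_) hyI
        rw [← hker, RingHom.mem_ker] at hcM
        rw [map_mul, hcM, mul_zero]
      · rw [IsLocalRing.eq_maximalIdeal hM, IsLocalRing.mem_maximalIdeal, mem_nonunits_iff,
          not_not] at hcM
        rw [← hc]
        exact (hcM.dvd_mul_right.mp dvd_rfl : (y : T) * c ∣ y)
  by_cases hsD : φ s ∈ D
  · exact Ideal.mem_span_singleton.mpr ⟨⟨s, hsD⟩, Subtype.ext hs⟩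
  -- If `φ s ∉ D`, then `1` and `φ s` span `K` over `D`, so modulo `M` the element `t` is an
  -- `R`-combination of `1` and `s`, and `tx` is one of `x` and `y = xs`, a contradiction.
  · obtain ⟨a, ha, b, hb, hab⟩ := hD _ hsD (φ t)
    obtain ⟨b, rfl⟩ := hφ b
    refine (htx ?_).elim
    rw [show t * (x : T) = (t - b * s) * x + b * y by rw [hs]; ring]
    refine Submodule.add_mem _ (hmul ?_ hxI) (hmul hb hyI)
    rw [Subring.mem_comap, map_sub, hab, map_mul, add_sub_cancel_right]
    exact ha

theorem IsCliffordRegular.comap_of_quadratic [ValuationRing T] {M : Ideal T}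
    (hM : M.IsMaximal) (hM0 : M ≠ ⊥) (hφ : Function.Surjective φ) (hker : RingHom.ker φ = M)
    (hD : ∀ s ∉ D, ∀ t, ∃ a ∈ D, ∃ b ∈ D, t = a + b * s) : IsCliffordRegular (D.comap φ) := by
  rw [isCliffordRegular_iff_ideal]
  intro I hI
  rcases isPrincipal_or_exists_restrictScalars_eq hM hφ hker hD I with ⟨x, hx⟩ | ⟨I', hI'⟩
  · refine ⟨⊤, x, ?_, by rw [Ideal.mul_top, ← hx]⟩
    rintro rfl
    simp [hx] at hI
  · obtain ⟨m, hm0, hm⟩ := exists_mem_ker_ne_zero (D := D) hM0 hker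
    have hI0 : I' ≠ ⊥ := by
      rintro rfl
      refine hI (idealImage_injective (F := T) algebraMap_comap_injective ?_)
      rw [hI', idealImage, Submodule.map_bot]
      rfl
    obtain ⟨J, a, ha, hJ⟩ := isCliffordRegular_iff_ideal.mp
      (ValuationRing.isCliffordRegular (V := T)) I' hI0
    -- Multiplying `I'²J = aI'` by `m` moves both `mJ` and `ma` into `R`.
    obtain ⟨J', hJ'⟩ := exists_idealImage_eq_span_singleton_mul
      (N := J.restrictScalars (D.comap φ)) (m := m) fun x _ => exists_algebraMap_eq_mul hm x
    obtain ⟨a', ha'⟩ := exists_algebraMap_eq_mul hm a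
    refine ⟨J', a', ?_, idealImage_injective (F := T) algebraMap_comap_injective ?_⟩
    · rintro rfl
      rw [map_zero, eq_comm] at ha'
      exact mul_ne_zero (fun h => hm0 (Subtype.ext h)) ha ha'
    · rw [idealImage_mul, idealImage_mul, idealImage_mul, idealImage_span_singleton, hJ', hI',
        mul_left_comm, ← restrictScalars_ideal_mul, ← restrictScalars_ideal_mul, hJ,
        restrictScalars_span_singleton_mul, ha', ← span_singleton_mul_span_singleton', mul_assoc]

theorem IsBooleRegular.comap_of_quadratic [ValuationRing T] (hT : IsStronglyDiscrete T)
    {M : Ideal T} (hM : M.IsMaximal) (hM0 : M ≠ ⊥) (hφ : Function.Surjective φ)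
    (hker : RingHom.ker φ = M) (hD : ∀ s ∉ D, ∀ t, ∃ a ∈ D, ∃ b ∈ D, t = a + b * s) :
    IsBooleRegular (D.comap φ) := by
  rw [isBooleRegular_iff_ideal]
  intro I hI
  rcases isPrincipal_or_exists_restrictScalars_eq hM hφ hker hD I with ⟨x, hx⟩ | ⟨I', hI'⟩
  · refine ⟨1, x, one_ne_zero, ?_, by rw [Ideal.span_singleton_one, Ideal.top_mul, ← hx]⟩
    rintro rfl
    simp [hx] at hI
  · obtain ⟨m, hm0, hm⟩ := exists_mem_ker_ne_zero (D := D) hM0 hker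
    have hI0 : I' ≠ ⊥ := by
      rintro rfl
      refine hI (idealImage_injective (F := T) algebraMap_comap_injective ?_)
      rw [hI', idealImage, Submodule.map_bot]
      rfl
    obtain ⟨z, hz, hJ⟩ := exists_mul_self_eq_span_singleton_mul hT hI0
    obtain ⟨z', hz'⟩ := exists_algebraMap_eq_mul hm z
    refine ⟨m, z', hm0, ?_, idealImage_injective (F := T) algebraMap_comap_injective ?_⟩
    · rintro rfl
      rw [map_zero, eq_comm] at hz'
      exact mul_ne_zero (fun h => hm0 (Subtype.ext h)) hz hz'
    · rw [idealImage_mul, idealImage_mul, idealImage_mul, idealImage_span_singleton,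
        idealImage_span_singleton, hI', ← restrictScalars_ideal_mul, hJ,
        restrictScalars_span_singleton_mul, hz', ← span_singleton_mul_span_singleton', mul_assoc]

end QuadraticPullback

/-! ### The main theorem -/

theorem theorem5p1 {T K : Type*} [CommRing T] [IsDomain T] [Field K]
    (M : Ideal T) (hM : M.IsMaximal) (hM0 : M ≠ ⊥)
    (φ : T →+* K) (hφ : Function.Surjective φ) (hker : RingHom.ker φ = M)
    (D : Subring K) (hD : D ≠ ⊤) :
    ((IsCliffordRegular (D.comap φ) →
        IsCliffordRegular T ∧ IsCliffordRegular D ∧ Module.rank (quotientFieldIn D) K ≤ 2) ∧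
      (IsBooleRegular (D.comap φ) →
        IsBooleRegular T ∧ IsBooleRegular D ∧ Module.rank (quotientFieldIn D) K ≤ 2)) ∧
    ((D : Set K) = quotientFieldIn D → ValuationRing T →
      (IsCliffordRegular (D.comap φ) ↔ Module.rank (quotientFieldIn D) K = 2) ∧
      (IsStronglyDiscrete T →
        (IsBooleRegular (D.comap φ) ↔ Module.rank (quotientFieldIn D) K = 2))) := by
  have hrank : IsCliffordRegular (D.comap φ) → Module.rank (quotientFieldIn D) K ≤ 2 := fun h =>
    rank_le_two_of_forall_exists_mul_mul_eq fun W hW => h.exists_mul_mul_eq hM hM0 hφ hker hW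
  have hclifford : IsBooleRegular (D.comap φ) → IsCliffordRegular (D.comap φ) :=
    isCliffordSemigroup_of_isBooleanSemigroup
  refine ⟨⟨fun h => ⟨h.of_comap hM0 hker, ?_, hrank h⟩,
    fun h => ⟨h.of_comap hM0 hker, ?_, hrank (hclifford h)⟩⟩, fun hDk hT => ?_⟩
  · exact isCliffordRegular_of_forall_exists_mul_mul_eq
      fun W hW => h.exists_mul_mul_eq hM hM0 hφ hker hW
  · exact isBooleRegular_of_forall_exists_mul_eq
      fun W hW => h.exists_mul_eq hM hM0 hφ hker hW
  · have hmem : ∀ x, x ∈ D ↔ x ∈ quotientFieldIn D := fun x => Set.ext_iff.mp hDk x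
    -- Properness of `D = k` excludes degree one, so the bound `≤ 2` becomes an equality.
    have hne : ∃ s, s ∉ quotientFieldIn D := by
      by_contra! h
      exact hD ((Subring.eq_top_iff' D).mpr fun x => (hmem x).mpr (h x))
    have hquad : Module.rank (quotientFieldIn D) K = 2 →
        ∀ s ∉ D, ∀ t, ∃ a ∈ D, ∃ b ∈ D, t = a + b * s := by
      intro h s hs t
      obtain ⟨a, ha, b, hb, hab⟩ := exists_eq_add_mul_of_rank_eq_two h (mt (hmem s).mpr hs) t
      exact ⟨a, (hmem a).mpr ha, b, (hmem b).mpr hb, hab⟩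
    exact ⟨⟨fun h => rank_eq_two_of_le hne (hrank h),
        fun h => .comap_of_quadratic hM hM0 hφ hker (hquad h)⟩,
      fun hsd => ⟨fun h => rank_eq_two_of_le hne (hrank (hclifford h)),
        fun h => .comap_of_quadratic hsd hM hM0 hφ hker (hquad h)⟩⟩
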